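/- Let $p\in\mathbb{R}[x_1,x_2]$ be a bivariate real polynomial of degree $4$, let $\mathcal C=\{x\in\mathbb{R}^2 : p(x)=0\}$ and let $\mathcal P=\operatorname{conv}\mathcal C$ be its convex hull. Let the first Lasserre relaxation $\mathcal P_2$ be the set of all $x\in\mathbb{R}^2$ for which there are real numbers $y_\alpha$ ($\alpha\in\mathbb{N}^2$, $|\alpha|\le 4$) with $y_{00}=1$, $y_{10}=x_1$, $y_{01}=x_2$, such that the moment matrix $M_2(y)=(y_{\alpha+\beta})_{|\alpha|,|\beta|\le 2}$ is positive semidefinite and $\sum_{\gamma}p_\gamma y_\gamma=0$, where $p(x)=\sum_\gamma p_\gamma x^\gamma$. If the function $x\mapsto p(x)$ is concave on $\mathbb{R}^2$, then $\mathcal P=\mathcal P_2$. -/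

import Mathlib

/-- The real algebraic plane curve `{x ∈ ℝ² : p(x) = 0}`. -/
def planeCurve (p : MvPolynomial (Fin 2) ℝ) : Set (Fin 2 → ℝ) :=
  {x | MvPolynomial.eval x p = 0}

/-- Exponents `α = (α₀, α₁)` of the bivariate monomials of degree at most `d`. -/
abbrev BivariateExponent (d : ℕ) : Type := {α : Fin 2 →₀ ℕ // α.degree ≤ d}

/-- The moment matrix `M_d(y)`, with entries `y_{α+β}` for `|α|, |β| ≤ d`. -/
noncomputable def momentMatrix (d : ℕ) (y : (Fin 2 →₀ ℕ) → ℝ) :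
    Matrix (BivariateExponent d) (BivariateExponent d) ℝ :=
  Matrix.of fun α β => y (α.1 + β.1)

/-- The localising matrix `M_d(p y)`, with entries `∑_γ p_γ y_{α+β+γ}` for `|α|, |β| ≤ d`. -/
noncomputable def localisingMatrix (d : ℕ) (p : MvPolynomial (Fin 2) ℝ) (y : (Fin 2 →₀ ℕ) → ℝ) :
    Matrix (BivariateExponent d) (BivariateExponent d) ℝ :=
  Matrix.of fun α β => ∑ γ ∈ p.support, p.coeff γ * y (α.1 + β.1 + γ)

/-- The Lasserre relaxation of order `k ≥ 2` of the convex hull of the quartic curve `p = 0`,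
in the affine chart `y₀₀ = 1`. When `p` has degree at most 4, only the moments `y_α` with
`|α| ≤ 2k` occur in the constraints, so that quantifying over a full sequence `y` is the same as
quantifying over a truncated one. -/
def lasserreRelaxation (k : ℕ) (p : MvPolynomial (Fin 2) ℝ) : Set (Fin 2 → ℝ) :=
  {x | ∃ y : (Fin 2 →₀ ℕ) → ℝ,
    y 0 = 1 ∧ y (Finsupp.single 0 1) = x 0 ∧ y (Finsupp.single 1 1) = x 1 ∧
    (momentMatrix k y).PosSemidef ∧ localisingMatrix (k - 2) p y = 0}

/-!
Both sides equal `{z | 0 ≤ p(z)}`.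

The relaxation is convex and contains the curve (take point evaluations as moments), hence contains
the convex hull. Conversely, let `y` be feasible with mean `z`, and let `ℓ` be the first-order
Taylor polynomial of `p` at `z`. By concavity `ℓ - p ≥ 0`, and this is a quartic whose expansion at
`z` starts in degree two. Such a quartic is a sum of squares of quadratics
(`mem_sumSq_quadratics`), so the Riesz functional of `y` is nonnegative on it, which gives
`p(z) = L_y(ℓ) ≥ L_y(p) = 0` (`eval_nonneg_of_mem_lasserreRelaxation`). Finally, on a line through
`z` along which the quartic part does not vanish, `p` tends to `-∞` at both ends, so `z` lies between
two zeros of `p` (`mem_convexHull_planeCurve`).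

The sum-of-squares statement is the case of Hilbert's theorem on ternary quartics in which the
quartic `f₂ + f₃ + f₄` has a real singular point. Nonnegativity amounts to `f₂ ≥ 0`, `f₄ ≥ 0` and
`4 f₂ f₄ - f₃² ≥ 0`. After a linear change of variables `f₂` is `0`, `X₁²` or `a = X₀² + X₁²`. The
first two cases reduce to nonnegative binary quartic forms. In the third, the key is that every
nonnegative binary form can be written `a σ + k²` with `σ` a sum of squares
(`exists_eq_mul_add_sq`): subtracting the largest admissible multiple of a power of `a` creates a
real zero, which splits off as the square of a linear form, and one inducts on the degree. Applied to the
discriminant, this makes `f₃² + k²` divisible by `a`, and factoring over `ℂ` yields the squares.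
-/

open MvPolynomial

/-! ### Sums of squares and auxiliary facts on binary forms -/

/-- Sums of squares of polynomials from a prescribed space `V`. -/
noncomputable def sumSq (V : Submodule ℝ (MvPolynomial (Fin 2) ℝ)) :
    AddSubmonoid (MvPolynomial (Fin 2) ℝ) :=
  AddSubmonoid.closure {f | ∃ g ∈ V, f = g ^ 2}

lemma sq_mem_sumSq {V : Submodule ℝ (MvPolynomial (Fin 2) ℝ)} {g : MvPolynomial (Fin 2) ℝ}
    (hg : g ∈ V) : g ^ 2 ∈ sumSq V :=
  AddSubmonoid.subset_closure ⟨g, hg, rfl⟩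

lemma map_mem_of_mem_sumSq {M : Type*} [AddCommMonoid M]
    {V : Submodule ℝ (MvPolynomial (Fin 2) ℝ)} {S : AddSubmonoid M}
    (φ : MvPolynomial (Fin 2) ℝ →+ M) (h : ∀ g ∈ V, φ (g ^ 2) ∈ S)
    {f : MvPolynomial (Fin 2) ℝ} (hf : f ∈ sumSq V) : φ f ∈ S := by
  have : sumSq V ≤ S.comap φ := by
    refine AddSubmonoid.closure_le.2 ?_
    rintro _ ⟨g, hg, rfl⟩
    exact h g hg
  exact this hf

lemma sumSq_mono {V W : Submodule ℝ (MvPolynomial (Fin 2) ℝ)} (h : V ≤ W) : sumSq V ≤ sumSq W :=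
  fun _ hf => map_mem_of_mem_sumSq (AddMonoidHom.id _) (fun _ hg => sq_mem_sumSq (h hg)) hf

lemma sq_mul_mem_sumSq {V W : Submodule ℝ (MvPolynomial (Fin 2) ℝ)} {f l : MvPolynomial (Fin 2) ℝ}
    (hl : ∀ g ∈ V, l * g ∈ W) (hf : f ∈ sumSq V) : l ^ 2 * f ∈ sumSq W :=
  map_mem_of_mem_sumSq (AddMonoidHom.mulLeft (l ^ 2))
    (fun g hg => by simpa [mul_pow] using sq_mem_sumSq (hl g hg)) hf

lemma C_mul_mem_sumSq {V : Submodule ℝ (MvPolynomial (Fin 2) ℝ)} {f : MvPolynomial (Fin 2) ℝ}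
    {c : ℝ} (hc : 0 ≤ c) (hf : f ∈ sumSq V) : C c * f ∈ sumSq V := by
  have := sq_mul_mem_sumSq (l := C (√c)) (W := V)
    (fun g hg => by simpa [C_mul'] using V.smul_mem (√c) hg) hf
  rwa [← C_pow, Real.sq_sqrt hc] at this

lemma algHom_mem_sumSq {V W : Submodule ℝ (MvPolynomial (Fin 2) ℝ)} {f : MvPolynomial (Fin 2) ℝ}
    (φ : MvPolynomial (Fin 2) ℝ →ₐ[ℝ] MvPolynomial (Fin 2) ℝ) (h : ∀ g ∈ V, φ g ∈ W)
    (hf : f ∈ sumSq V) : φ f ∈ sumSq W :=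
  map_mem_of_mem_sumSq (φ : MvPolynomial (Fin 2) ℝ →+ MvPolynomial (Fin 2) ℝ)
    (fun g hg => by simpa using sq_mem_sumSq (h g hg)) hf

lemma eval_comp_algHom (φ : MvPolynomial (Fin 2) ℝ →ₐ[ℝ] MvPolynomial (Fin 2) ℝ)
    (x : Fin 2 → ℝ) (f : MvPolynomial (Fin 2) ℝ) :
    eval x (φ f) = eval (fun i => eval x (φ (X i))) f := by
  have : (aeval x).comp φ = aeval (fun i => eval x (φ (X i))) := by
    ext i; simp [aeval_eq_eval]
  simpa [aeval_eq_eval] using DFunLike.congr_fun this f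

lemma eval_smul_of_isHomogeneous {n : ℕ} {f : MvPolynomial (Fin 2) ℝ} (hf : f.IsHomogeneous n)
    (t : ℝ) (v : Fin 2 → ℝ) : eval (t • v) f = t ^ n * eval v f := by
  rw [eval_eq, eval_eq, Finset.mul_sum]
  refine Finset.sum_congr rfl fun d hd => ?_
  have h : n = ∑ i ∈ d.support, d i := hf.degree_eq_sum_deg_support hd
  simp only [Pi.smul_apply, smul_eq_mul, mul_pow, Finset.prod_mul_distrib,
    Finset.prod_pow_eq_pow_sum, ← h]
  ring

/-- A form is split into its pure power of `X 0` and a multiple of `X 1`; iterating this lists the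
coefficients of a binary form. -/
lemma exists_eq_C_mul_X_pow_add {n : ℕ} {f : MvPolynomial (Fin 2) ℝ}
    (hf : f.IsHomogeneous (n + 1)) :
    ∃ (c : ℝ) (g : MvPolynomial (Fin 2) ℝ), g.IsHomogeneous n ∧
      f = C c * X 0 ^ (n + 1) + X 1 * g := by
  refine ⟨coeff (Finsupp.single 0 (n + 1)) f, f.divMonomial (Finsupp.single 1 1), ?_, ?_⟩
  · intro d hd
    rw [coeff_divMonomial] at hd
    have := hf hd
    rw [map_add, Finsupp.weight_single] at this
    simp only [Pi.one_apply, smul_eq_mul, mul_one] at this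
    omega
  · conv_lhs => rw [← divMonomial_add_modMonomial_single f 1, add_comm]
    congr 1
    ext d
    rw [X_pow_eq_monomial, C_mul_monomial, coeff_monomial, mul_one]
    by_cases h : Finsupp.single 1 1 ≤ d
    · rw [coeff_modMonomial_of_le _ h, if_neg]
      rintro rfl
      simpa using h 1
    · rw [coeff_modMonomial_of_not_le _ h]
      have h1 : d 1 = 0 := by
        by_contra h1
        exact h (by simpa using Nat.one_le_iff_ne_zero.2 h1)
      split_ifs with h2
      · rw [h2]
      · refine hf.coeff_eq_zero fun h3 => h2 ?_
        rw [Finsupp.degree_eq_sum, Fin.sum_univ_two, h1] at h3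
        ext i
        fin_cases i <;> simp [h1]; omega

lemma nonneg_of_forall_pos {φ : ℝ → ℝ} (hφ : Continuous φ) (h : ∀ t, 0 < t → t < 1 → 0 ≤ φ t) :
    0 ≤ φ 0 := by
  have hlim : Filter.Tendsto φ (nhdsWithin 0 (Set.Ioi 0)) (nhds (φ 0)) :=
    (hφ.tendsto 0).mono_left nhdsWithin_le_nhds
  refine ge_of_tendsto hlim ?_
  filter_upwards [Ioo_mem_nhdsGT one_pos] with t ht using h t ht.1 ht.2

lemma eval_nonneg_of_forall_ne {f : MvPolynomial (Fin 2) ℝ}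
    (h : ∀ x : Fin 2 → ℝ, x 1 ≠ 0 → 0 ≤ eval x f) (x : Fin 2 → ℝ) : 0 ≤ eval x f := by
  by_cases hx : x 1 = 0
  · have := nonneg_of_forall_pos (φ := fun t => eval ![x 0, t] f)
      (f.continuous_eval.comp (by fun_prop)) (fun t ht _ => h _ (by simpa using ht.ne'))
    have hx' : x = ![x 0, 0] := by ext i; fin_cases i <;> simp [hx]
    rwa [hx']
  · exact h x hx

/-! ### Nonnegative binary forms -/

/-- A nonnegative form vanishing on the `x₀`-axis is divisible by `X₁²`, with nonnegative
cofactor. -/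
lemma exists_eq_X_sq_mul {n : ℕ} {f : MvPolynomial (Fin 2) ℝ} (hf : f.IsHomogeneous (n + 2))
    (hpos : ∀ x, 0 ≤ eval x f) (h0 : eval ![1, 0] f = 0) :
    ∃ g : MvPolynomial (Fin 2) ℝ, g.IsHomogeneous n ∧ (∀ x, 0 ≤ eval x g) ∧ f = X 1 ^ 2 * g := by
  obtain ⟨c, g, hg, rfl⟩ := exists_eq_C_mul_X_pow_add hf
  obtain rfl : c = 0 := by simpa using h0
  obtain ⟨d, k, hk, rfl⟩ := exists_eq_C_mul_X_pow_add hg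
  -- the sign change of `X 1` forces the cofactor to vanish on the axis
  have h1 : 0 ≤ d := by
    have := nonneg_of_forall_pos
      (φ := fun t => eval ![1, t] (C d * X 0 ^ (n + 1) + X 1 * k))
      ((MvPolynomial.continuous_eval _).comp (by fun_prop)) (fun t ht _ => by
        have := hpos ![1, t]
        simp only [map_add, map_mul, eval_X, eval_C, map_zero, zero_mul, zero_add] at this ⊢
        exact nonneg_of_mul_nonneg_right this (by simpa using ht))
    simpa using this
  have h2 : 0 ≤ -d := by
    have := nonneg_of_forall_pos
      (φ := fun t => -eval ![1, -t] (C d * X 0 ^ (n + 1) + X 1 * k))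
      (((MvPolynomial.continuous_eval _).comp (by fun_prop)).neg) (fun t ht _ => by
        have := hpos ![1, -t]
        simp only [map_add, map_mul, eval_X, eval_C, map_zero, zero_mul, zero_add] at this ⊢
        simp at this ⊢
        nlinarith)
    simpa using this
  obtain rfl : d = 0 := by linarith
  refine ⟨k, hk, eval_nonneg_of_forall_ne fun x hx => ?_, by simp; ring⟩
  have := hpos x
  simp only [map_mul, eval_X, map_zero, zero_mul, zero_add, ← mul_assoc] at this
  exact nonneg_of_mul_nonneg_right this (mul_self_pos.2 hx)

/-- The linear change of variables `X 0 ↦ a X 0 + b X 1`, `X 1 ↦ c X 0 + d X 1`. The composite of two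
of these is given by the product of their matrices in reversed order. -/
noncomputable def linSubst (a b c d : ℝ) : MvPolynomial (Fin 2) ℝ →ₐ[ℝ] MvPolynomial (Fin 2) ℝ :=
  aeval ![C a * X 0 + C b * X 1, C c * X 0 + C d * X 1]

lemma linSubst_isHomogeneous (a b c d : ℝ) {n : ℕ} {f : MvPolynomial (Fin 2) ℝ}
    (hf : f.IsHomogeneous n) : (linSubst a b c d f).IsHomogeneous n := by
  have := hf.aeval (τ := Fin 2) ![C a * X 0 + C b * X 1, C c * X 0 + C d * X 1] (n := 1) (by
    intro i
    fin_cases i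
    · exact (isHomogeneous_C_mul_X a 0).add (isHomogeneous_C_mul_X b 1)
    · exact (isHomogeneous_C_mul_X c 0).add (isHomogeneous_C_mul_X d 1))
  simpa [linSubst] using this

lemma eval_linSubst (a b c d : ℝ) (x : Fin 2 → ℝ) (f : MvPolynomial (Fin 2) ℝ) :
    eval x (linSubst a b c d f) = eval ![a * x 0 + b * x 1, c * x 0 + d * x 1] f := by
  rw [eval_comp_algHom]
  congr 2
  ext i; fin_cases i <;> simp [linSubst]

/-- The hypotheses say that the two coefficient matrices are inverse to each other. -/
lemma linSubst_linSubst {a b c d a' b' c' d' : ℝ} (h1 : a * a' + b * c' = 1)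
    (h2 : a * b' + b * d' = 0) (h3 : c * a' + d * c' = 0) (h4 : c * b' + d * d' = 1)
    (f : MvPolynomial (Fin 2) ℝ) : linSubst a' b' c' d' (linSubst a b c d f) = f := by
  refine MvPolynomial.funext fun x => ?_
  rw [eval_linSubst, eval_linSubst]
  congr 2
  ext i; fin_cases i
  · simp; linear_combination x 0 * h1 + x 1 * h2
  · simp; linear_combination x 0 * h3 + x 1 * h4

/-- One step of the reduction of a nonnegative binary form: subtracting the largest admissible
multiple of `(X₀² + X₁²)ᵈ` creates a real zero, which splits off as a squared linear form. -/
lemma exists_eq_C_mul_pow_add_sq_mul {n : ℕ} {f : MvPolynomial (Fin 2) ℝ}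
    (hf : f.IsHomogeneous (2 * (n + 1))) (hpos : ∀ x, 0 ≤ eval x f) :
    ∃ (c : ℝ) (l g : MvPolynomial (Fin 2) ℝ), 0 ≤ c ∧ l.IsHomogeneous 1 ∧
      g.IsHomogeneous (2 * n) ∧ (∀ x, 0 ≤ eval x g) ∧
      f = C c * (X 0 ^ 2 + X 1 ^ 2) ^ (n + 1) + l ^ 2 * g := by
  obtain ⟨θ, -, hθ⟩ := isCompact_Icc.exists_isMinOn (s := Set.Icc (0 : ℝ) (2 * Real.pi))
    (f := fun θ => eval ![Real.cos θ, Real.sin θ] f)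
    (Set.nonempty_Icc.2 (by positivity))
    (f.continuous_eval.comp (by fun_prop)).continuousOn
  set s := Real.sin θ
  set u := Real.cos θ
  have hsu : s ^ 2 + u ^ 2 = 1 := Real.sin_sq_add_cos_sq θ
  set c := eval ![u, s] f with hc
  have hmin : ∀ x : Fin 2 → ℝ, c * (x 0 ^ 2 + x 1 ^ 2) ^ (n + 1) ≤ eval x f := by
    intro x
    -- polar coordinates, with the argument moved into `[0, 2π]`
    set z : ℂ := ⟨x 0, x 1⟩
    have hz0 : x 0 = ‖z‖ * Real.cos z.arg := (Complex.norm_mul_cos_arg z).symm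
    have hz1 : x 1 = ‖z‖ * Real.sin z.arg := (Complex.norm_mul_sin_arg z).symm
    have hx : x = ‖z‖ • ![Real.cos z.arg, Real.sin z.arg] := by
      ext i; fin_cases i
      · simpa using hz0
      · simpa using hz1
    obtain ⟨ψ, hψ, h1, h2⟩ : ∃ ψ ∈ Set.Icc (0 : ℝ) (2 * Real.pi),
        Real.cos ψ = Real.cos z.arg ∧ Real.sin ψ = Real.sin z.arg := by
      rcases le_total 0 z.arg with h | h
      · exact ⟨z.arg, ⟨h, by linarith [Complex.arg_le_pi z, Real.pi_pos]⟩, rfl, rfl⟩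
      · exact ⟨z.arg + 2 * Real.pi, ⟨by linarith [Complex.neg_pi_lt_arg z, Real.pi_pos],
          by linarith⟩, by simp, by simp⟩
    have h3 := hθ hψ
    simp only [Set.mem_ofPred_eq, h1, h2] at h3
    have h4 : x 0 ^ 2 + x 1 ^ 2 = ‖z‖ ^ 2 := by
      rw [hz0, hz1]; linear_combination ‖z‖ ^ 2 * Real.sin_sq_add_cos_sq z.arg
    rw [h4, hx, eval_smul_of_isHomogeneous hf, ← pow_mul, mul_comm]
    exact mul_le_mul_of_nonneg_left h3 (by positivity)
  have ha : (X 0 ^ 2 + X 1 ^ 2 : MvPolynomial (Fin 2) ℝ).IsHomogeneous 2 :=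
    (isHomogeneous_X_pow 0 2).add (isHomogeneous_X_pow 1 2)
  have hr : (f - C c * (X 0 ^ 2 + X 1 ^ 2) ^ (n + 1)).IsHomogeneous (2 * n + 2) :=
    hf.sub ((ha.pow (n + 1)).C_mul c)
  -- rotate the minimiser `(u, s)` to `(1, 0)`
  obtain ⟨g, hg, hgpos, hfg⟩ := exists_eq_X_sq_mul (linSubst_isHomogeneous u (-s) s u hr)
    (fun x => by
      rw [eval_linSubst]
      have := hmin ![u * x 0 + -s * x 1, s * x 0 + u * x 1]
      simpa using this)
    (by
      rw [eval_linSubst]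
      have : u ^ 2 + s ^ 2 = 1 := by linarith
      simp [this, hc])
  refine ⟨c, linSubst u s (-s) u (X 1), linSubst u s (-s) u g, hpos _,
    linSubst_isHomogeneous _ _ _ _ (isHomogeneous_X _ _), linSubst_isHomogeneous _ _ _ _ hg,
    fun x => by rw [eval_linSubst]; exact hgpos _, ?_⟩
  have := congrArg (linSubst u s (-s) u) hfg
  rw [linSubst_linSubst (by linarith) (by ring) (by ring) (by linarith), map_mul, map_pow] at this
  rw [← this]; ring

lemma X_sq_add_X_sq_mul_mem_sumSq {n : ℕ} {f : MvPolynomial (Fin 2) ℝ}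
    (hf : f ∈ sumSq (homogeneousSubmodule (Fin 2) ℝ n)) :
    (X 0 ^ 2 + X 1 ^ 2) * f ∈ sumSq (homogeneousSubmodule (Fin 2) ℝ (n + 1)) := by
  rw [add_mul]
  refine add_mem ?_ ?_ <;>
  · refine sq_mul_mem_sumSq (fun g hg => ?_) hf
    rw [add_comm]
    exact (isHomogeneous_X _ _).mul hg

lemma X_sq_add_X_sq_pow_mem_sumSq (n : ℕ) :
    ((X 0 ^ 2 + X 1 ^ 2) ^ n : MvPolynomial (Fin 2) ℝ) ∈
      sumSq (homogeneousSubmodule (Fin 2) ℝ n) := by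
  induction n with
  | zero =>
    have := sq_mem_sumSq (V := homogeneousSubmodule (Fin 2) ℝ 0) (isHomogeneous_one (Fin 2) ℝ)
    rwa [one_pow] at this
  | succ n ih => rw [pow_succ']; exact X_sq_add_X_sq_mul_mem_sumSq ih

lemma exists_eq_C_of_isHomogeneous_zero {f : MvPolynomial (Fin 2) ℝ} (hf : f.IsHomogeneous 0) :
    ∃ c, f = C c :=
  ⟨_, totalDegree_eq_zero_iff_eq_C.1 (Nat.le_zero.1 hf.totalDegree_le)⟩

/-- A nonnegative binary form is a multiple of `X₀² + X₁²` by a sum of squares, plus the square of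
a single form. -/
lemma exists_eq_mul_add_sq {n : ℕ} {f : MvPolynomial (Fin 2) ℝ}
    (hf : f.IsHomogeneous (2 * (n + 1))) (hpos : ∀ x, 0 ≤ eval x f) :
    ∃ σ ∈ sumSq (homogeneousSubmodule (Fin 2) ℝ n), ∃ k : MvPolynomial (Fin 2) ℝ,
      k.IsHomogeneous (n + 1) ∧ f = (X 0 ^ 2 + X 1 ^ 2) * σ + k ^ 2 := by
  induction n generalizing f with
  | zero =>
    obtain ⟨c, l, g, hc, hl, hg, hgpos, rfl⟩ := exists_eq_C_mul_pow_add_sq_mul hf hpos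
    obtain ⟨d, rfl⟩ := exists_eq_C_of_isHomogeneous_zero hg
    have hd : 0 ≤ d := by simpa using hgpos 0
    refine ⟨C c * 1, C_mul_mem_sumSq hc ?_, C √d * l, hl.C_mul _, ?_⟩
    · simpa using X_sq_add_X_sq_pow_mem_sumSq 0
    · rw [mul_pow, ← C_pow, Real.sq_sqrt hd]; ring
  | succ n ih =>
    obtain ⟨c, l, g, hc, hl, hg, hgpos, rfl⟩ := exists_eq_C_mul_pow_add_sq_mul hf hpos
    obtain ⟨σ, hσ, k, hk, rfl⟩ := ih hg hgpos
    refine ⟨C c * (X 0 ^ 2 + X 1 ^ 2) ^ (n + 1) + l ^ 2 * σ,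
      add_mem (C_mul_mem_sumSq hc (X_sq_add_X_sq_pow_mem_sumSq _))
        (sq_mul_mem_sumSq (fun g hg => ?_) hσ), l * k, ?_, by ring⟩
    · rw [add_comm]; exact hl.mul hg
    · rw [add_comm]; exact hl.mul hk

/-! ### Nonnegative quartics with a singular zero at the origin -/

/-- The space of polynomials of degree at most two. -/
noncomputable abbrev quadratics : Submodule ℝ (MvPolynomial (Fin 2) ℝ) :=
  restrictTotalDegree (Fin 2) ℝ 2

lemma mem_quadratics_of_isHomogeneous {n : ℕ} {f : MvPolynomial (Fin 2) ℝ}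
    (hf : f.IsHomogeneous n) (hn : n ≤ 2) : f ∈ quadratics :=
  (mem_restrictTotalDegree _ _ _).2 (hf.totalDegree_le.trans hn)

lemma mem_sumSq_quadratics_of_isHomogeneous_four {f : MvPolynomial (Fin 2) ℝ}
    (hf : f.IsHomogeneous 4) (hpos : ∀ x, 0 ≤ eval x f) : f ∈ sumSq quadratics := by
  obtain ⟨σ, hσ, k, hk, rfl⟩ := exists_eq_mul_add_sq (n := 1) hf hpos
  exact add_mem (sumSq_mono (fun g hg => mem_quadratics_of_isHomogeneous hg le_rfl)
    (X_sq_add_X_sq_mul_mem_sumSq hσ)) (sq_mem_sumSq (mem_quadratics_of_isHomogeneous hk le_rfl))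

/-- Along each line through the origin, a nonnegative polynomial with components in degrees two,
three and four is `t²` times a nonnegative quadratic polynomial in `t`. -/
lemma eval_component_inequalities {f₂ f₃ f₄ : MvPolynomial (Fin 2) ℝ} (h₂ : f₂.IsHomogeneous 2)
    (h₃ : f₃.IsHomogeneous 3) (h₄ : f₄.IsHomogeneous 4)
    (hpos : ∀ x, 0 ≤ eval x (f₂ + f₃ + f₄)) (x : Fin 2 → ℝ) :
    0 ≤ eval x f₂ ∧ 0 ≤ eval x f₄ ∧ eval x f₃ ^ 2 ≤ 4 * eval x f₂ * eval x f₄ := by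
  have key : ∀ t : ℝ, t ≠ 0 → 0 ≤ eval x f₂ + t * eval x f₃ + t ^ 2 * eval x f₄ := by
    intro t ht
    have := hpos (t • x)
    rw [map_add, map_add, eval_smul_of_isHomogeneous h₂, eval_smul_of_isHomogeneous h₃,
      eval_smul_of_isHomogeneous h₄] at this
    have h : 0 ≤ t ^ 2 * (eval x f₂ + t * eval x f₃ + t ^ 2 * eval x f₄) := by linarith
    exact nonneg_of_mul_nonneg_right h (by positivity)
  have h0 : 0 ≤ eval x f₂ := by
    simpa using nonneg_of_forall_pos
      (φ := fun t => eval x f₂ + t * eval x f₃ + t ^ 2 * eval x f₄) (by fun_prop)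
      (fun t ht _ => key t ht.ne')
  have h4 : 0 ≤ eval x f₄ := by
    simpa using nonneg_of_forall_pos
      (φ := fun t => t * (t * eval x f₂ + eval x f₃) + eval x f₄) (by fun_prop)
      (fun t ht _ => by
        have := mul_nonneg (sq_nonneg t) (key t⁻¹ (inv_ne_zero ht.ne'))
        field_simp at this
        linarith)
  refine ⟨h0, h4, ?_⟩
  have hd := discrim_le_zero (a := eval x f₄) (b := eval x f₃) (c := eval x f₂) (fun t => by
    rcases eq_or_ne t 0 with rfl | ht
    · simpa using h0
    · linarith [key t ht])
  rw [discrim] at hd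
  linarith

lemma eq_zero_of_eval_sq_le {f : MvPolynomial (Fin 2) ℝ} (h : ∀ x, eval x f ^ 2 ≤ 0) : f = 0 :=
  MvPolynomial.funext fun x => by
    simpa using le_antisymm (h x) (sq_nonneg _)

/-- Degenerate quadratic part: the cubic part is then divisible by `X₁`, and completing the square
leaves a nonnegative quartic form. -/
lemma mem_sumSq_of_quadratic_part_eq_X_sq {f₃ f₄ : MvPolynomial (Fin 2) ℝ}
    (h₃ : f₃.IsHomogeneous 3) (h₄ : f₄.IsHomogeneous 4)
    (hpos : ∀ x, 0 ≤ eval x (X 1 ^ 2 + f₃ + f₄)) : X 1 ^ 2 + f₃ + f₄ ∈ sumSq quadratics := by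
  have hineq := eval_component_inequalities (isHomogeneous_X_pow 1 2) h₃ h₄ hpos
  obtain ⟨c, b, hb, rfl⟩ := exists_eq_C_mul_X_pow_add h₃
  obtain rfl : c = 0 := by simpa using (hineq ![1, 0]).2.2
  have h : X 1 ^ 2 + (C 0 * X 0 ^ (2 + 1) + X 1 * b) + f₄ =
      (X 1 + C (1 / 2) * b) ^ 2 + (f₄ - C (1 / 4) * b ^ 2) := by
    have : (C (1 / 4) : MvPolynomial (Fin 2) ℝ) = C (1 / 2) ^ 2 := by rw [← C_pow]; norm_num
    have h' : (2 * C (1 / 2) : MvPolynomial (Fin 2) ℝ) = 1 := by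
      rw [← map_ofNat C 2, ← C_mul]; norm_num
    rw [this, map_zero]; linear_combination -(X 1 * b) * h'
  rw [h]
  refine add_mem (sq_mem_sumSq (add_mem
    (mem_quadratics_of_isHomogeneous (isHomogeneous_X _ _) one_le_two)
    (mem_quadratics_of_isHomogeneous (hb.C_mul _) le_rfl)))
    (mem_sumSq_quadratics_of_isHomogeneous_four (h₄.sub ((hb.pow 2).C_mul _)) ?_)
  refine eval_nonneg_of_forall_ne fun x hx => ?_
  have := (hineq x).2.2
  simp only [map_mul, map_zero, zero_mul, zero_add, map_pow, eval_X, map_sub, eval_C] at this ⊢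
  have h' : 0 ≤ x 1 ^ 2 * (eval x f₄ - 1 / 4 * eval x b ^ 2) := by linarith
  exact nonneg_of_mul_nonneg_right h' (by positivity)

/-- If `b² + k²` is divisible by `X₀² + X₁² = (X₀ + iX₁)(X₀ - iX₁)`, then `X₀ + iX₁` divides
`b + ik` over `ℂ`, up to replacing `k` by `-k`; the cofactor is `m + in`. -/
lemma exists_eq_of_sq_add_sq_eq {b k e : MvPolynomial (Fin 2) ℝ} (hb : b.IsHomogeneous 3)
    (hk : k.IsHomogeneous 3) (h : b ^ 2 + k ^ 2 = (X 0 ^ 2 + X 1 ^ 2) * e) :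
    ∃ m n : MvPolynomial (Fin 2) ℝ, m.IsHomogeneous 2 ∧ n.IsHomogeneous 2 ∧
      b = X 0 * m - X 1 * n ∧ e = m ^ 2 + n ^ 2 := by
  have main : ∀ k : MvPolynomial (Fin 2) ℝ, k.IsHomogeneous 3 →
      b ^ 2 + k ^ 2 = (X 0 ^ 2 + X 1 ^ 2) * e →
      aeval ![-Complex.I, 1] b + Complex.I * aeval ![-Complex.I, 1] k = 0 →
      ∃ m n : MvPolynomial (Fin 2) ℝ, m.IsHomogeneous 2 ∧ n.IsHomogeneous 2 ∧
        b = X 0 * m - X 1 * n ∧ e = m ^ 2 + n ^ 2 := by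
    clear h hk k
    intro k hk h hroot
    obtain ⟨b₀, b', hb', rfl⟩ := exists_eq_C_mul_X_pow_add hb
    obtain ⟨b₁, b'', hb'', rfl⟩ := exists_eq_C_mul_X_pow_add hb'
    obtain ⟨b₂, b''', hb''', rfl⟩ := exists_eq_C_mul_X_pow_add hb''
    obtain ⟨b₃, rfl⟩ := exists_eq_C_of_isHomogeneous_zero hb'''
    obtain ⟨k₀, k', hk', rfl⟩ := exists_eq_C_mul_X_pow_add hk
    obtain ⟨k₁, k'', hk'', rfl⟩ := exists_eq_C_mul_X_pow_add hk'
    obtain ⟨k₂, k''', hk''', rfl⟩ := exists_eq_C_mul_X_pow_add hk''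
    obtain ⟨k₃, rfl⟩ := exists_eq_C_of_isHomogeneous_zero hk'''
    have hre := congrArg Complex.re hroot
    have him := congrArg Complex.im hroot
    simp [pow_succ] at hre him
    -- real and imaginary parts of the vanishing of `b + ik` at the zero `(-i, 1)` of `X₀ + iX₁`
    have e₁ : b₂ = k₃ - k₁ + b₀ := by linarith
    have e₂ : k₂ = b₁ - b₃ + k₀ := by linarith
    subst e₁ e₂
    have hq : ∀ p q r : ℝ, (C p * X 0 ^ 2 + C q * (X 0 * X 1) + C r * X 1 ^ 2 :
        MvPolynomial (Fin 2) ℝ).IsHomogeneous 2 := fun p q r =>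
      (((isHomogeneous_X_pow 0 2).C_mul p).add
        (((isHomogeneous_X ℝ 0).mul (isHomogeneous_X ℝ 1)).C_mul q)).add
        ((isHomogeneous_X_pow 1 2).C_mul r)
    refine ⟨_, _, hq b₀ (b₁ + k₀) k₃, hq k₀ (k₁ - b₀) (-b₃), ?_, ?_⟩
    · simp only [map_add, map_sub, map_neg]; ring
    · have ha : (X 0 ^ 2 + X 1 ^ 2 : MvPolynomial (Fin 2) ℝ) ≠ 0 := fun h0 => by
        simpa using congrArg (eval ![1, 0]) h0
      refine mul_left_cancel₀ ha ?_
      rw [← h]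
      simp only [map_add, map_sub, map_neg]; ring
  have hI : aeval (![-Complex.I, 1] : Fin 2 → ℂ) b ^ 2 + aeval ![-Complex.I, 1] k ^ 2 = 0 := by
    simpa using congrArg (aeval (![-Complex.I, 1] : Fin 2 → ℂ)) h
  have hfac : (aeval (![-Complex.I, 1] : Fin 2 → ℂ) b + Complex.I * aeval ![-Complex.I, 1] k) *
      (aeval (![-Complex.I, 1] : Fin 2 → ℂ) b - Complex.I * aeval ![-Complex.I, 1] k) = 0 := by
    linear_combination hI - (aeval (![-Complex.I, 1] : Fin 2 → ℂ) k) ^ 2 * Complex.I_sq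
  rcases mul_eq_zero.1 hfac with h0 | h0
  · exact main k hk h h0
  · exact main (-k) hk.neg (by rw [neg_sq]; exact h) (by rw [map_neg]; linear_combination h0)

/-- Definite quadratic part `a = X₀² + X₁²`. Writing the discriminant as `4 a f₄ - f₃² = a σ + k²`
makes `f₃² + k²` divisible by `a`, hence `f₃ = X₀ m - X₁ n` and `4 f₄ - σ = m² + n²`, so that
`4 (a + f₃ + f₄) = (2 X₀ + m)² + (2 X₁ - n)² + σ`. -/
lemma mem_sumSq_of_quadratic_part_eq_X_sq_add_X_sq {f₃ f₄ : MvPolynomial (Fin 2) ℝ}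
    (h₃ : f₃.IsHomogeneous 3) (h₄ : f₄.IsHomogeneous 4)
    (hpos : ∀ x, 0 ≤ eval x (X 0 ^ 2 + X 1 ^ 2 + f₃ + f₄)) :
    X 0 ^ 2 + X 1 ^ 2 + f₃ + f₄ ∈ sumSq quadratics := by
  have ha : (X 0 ^ 2 + X 1 ^ 2 : MvPolynomial (Fin 2) ℝ).IsHomogeneous 2 :=
    (isHomogeneous_X_pow 0 2).add (isHomogeneous_X_pow 1 2)
  have hineq := eval_component_inequalities ha h₃ h₄ hpos
  -- the discriminant is a nonnegative sextic form
  obtain ⟨σ, hσ, k, hk, hD⟩ := exists_eq_mul_add_sq (n := 2)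
    (f := C 4 * ((X 0 ^ 2 + X 1 ^ 2) * f₄) - f₃ ^ 2)
    (((ha.mul h₄).C_mul 4).sub (h₃.pow 2)) (fun x => by
      have := (hineq x).2.2
      simp only [map_sub, map_mul, eval_C, map_pow]
      linarith)
  obtain ⟨m, n, hm, hn, hb, he⟩ := exists_eq_of_sq_add_sq_eq (e := C 4 * f₄ - σ) h₃ hk
    (by linear_combination -hD)
  have h : X 0 ^ 2 + X 1 ^ 2 + f₃ + f₄ =
      C (1 / 4) * ((C 2 * X 0 + m) ^ 2 + (C 2 * X 1 - n) ^ 2 + σ) := by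
    have h4 : (C (1 / 4) * C 4 : MvPolynomial (Fin 2) ℝ) = 1 := by
      rw [← C_mul]; norm_num
    have h2 : (C 2 : MvPolynomial (Fin 2) ℝ) = 2 := map_ofNat C 2
    have h4' : (C 4 : MvPolynomial (Fin 2) ℝ) = 4 := map_ofNat C 4
    rw [h4'] at he h4
    rw [h2, hb]
    linear_combination (-(X 0 ^ 2 + X 1 ^ 2 + (X 0 * m - X 1 * n) + f₄)) * h4 + C (1 / 4) * he
  rw [h]
  have hlin (i : Fin 2) : (C 2 * X i : MvPolynomial (Fin 2) ℝ) ∈ quadratics :=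
    mem_quadratics_of_isHomogeneous (isHomogeneous_C_mul_X 2 i) one_le_two
  refine C_mul_mem_sumSq (by norm_num) (add_mem (add_mem (sq_mem_sumSq ?_) (sq_mem_sumSq ?_))
    (sumSq_mono (fun g hg => mem_quadratics_of_isHomogeneous hg le_rfl) hσ))
  · exact add_mem (hlin 0) (mem_quadratics_of_isHomogeneous hm le_rfl)
  · exact sub_mem (hlin 1) (mem_quadratics_of_isHomogeneous hn le_rfl)

lemma totalDegree_aeval_le {l : Fin 2 → MvPolynomial (Fin 2) ℝ} (hl : ∀ i, (l i).totalDegree ≤ 1)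
    {n : ℕ} {g : MvPolynomial (Fin 2) ℝ} (hg : g.totalDegree ≤ n) :
    (aeval l g).totalDegree ≤ n := by
  rw [aeval_def, eval₂_eq]
  refine totalDegree_finsetSum_le fun d hd => (totalDegree_mul _ _).trans ?_
  rw [algebraMap_eq, totalDegree_C, zero_add]
  refine (totalDegree_finsetProd _ _).trans (le_trans (Finset.sum_le_sum (g := d) fun i _ =>
    (totalDegree_pow _ _).trans (mul_le_of_le_one_right (Nat.zero_le _) (hl i))) ?_)
  exact (le_totalDegree hd).trans hg

lemma exists_linSubst_inverse {a b c d : ℝ} (h : a * d - b * c ≠ 0) :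
    ∃ a' b' c' d' : ℝ, (∀ g, linSubst a b c d (linSubst a' b' c' d' g) = g) ∧
      ∀ g, linSubst a' b' c' d' (linSubst a b c d g) = g := by
  set Δ := a * d - b * c with hΔ
  have hΔ1 : Δ * Δ⁻¹ = 1 := mul_inv_cancel₀ h
  refine ⟨d * Δ⁻¹, -b * Δ⁻¹, -c * Δ⁻¹, a * Δ⁻¹,
    linSubst_linSubst ?_ ?_ ?_ ?_, linSubst_linSubst ?_ ?_ ?_ ?_⟩ <;>
  first
  | ring1
  | linear_combination hΔ1 - Δ⁻¹ * hΔ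

/-- A positive semidefinite binary quadratic form is `0`, `X₁²` or `X₀² + X₁²` up to an invertible
linear change of variables. -/
lemma exists_eq_linSubst {f : MvPolynomial (Fin 2) ℝ} (hf : f.IsHomogeneous 2)
    (hpos : ∀ x, 0 ≤ eval x f) :
    f = 0 ∨ ∃ a b c d : ℝ, a * d - b * c ≠ 0 ∧
      (f = linSubst a b c d (X 1 ^ 2) ∨ f = linSubst a b c d (X 0 ^ 2 + X 1 ^ 2)) := by
  obtain ⟨α, f', hf', rfl⟩ := exists_eq_C_mul_X_pow_add hf
  obtain ⟨β, f'', hf'', rfl⟩ := exists_eq_C_mul_X_pow_add hf'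
  obtain ⟨γ, rfl⟩ := exists_eq_C_of_isHomogeneous_zero hf''
  have hval : ∀ s t : ℝ, 0 ≤ α * (s * s) + (β * t) * s + γ * t ^ 2 := fun s t => by
    have := hpos ![s, t]
    simp at this
    linarith
  have hα : 0 ≤ α := by simpa using hval 1 0
  have hγ : 0 ≤ γ := by simpa using hval 0 1
  have hdisc : β ^ 2 ≤ 4 * α * γ := by
    have := discrim_le_zero (fun s => by simpa using hval s 1)
    rw [discrim] at this
    linarith
  rcases hα.eq_or_lt with rfl | hα
  · obtain rfl : β = 0 := by nlinarith
    rcases hγ.eq_or_lt with rfl | hγ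
    · exact Or.inl (by simp)
    · refine Or.inr ⟨1, 0, 0, √γ, by simpa using (Real.sqrt_pos.2 hγ).ne', Or.inl ?_⟩
      refine MvPolynomial.funext fun x => ?_
      rw [eval_linSubst]
      simp [mul_pow, Real.sq_sqrt hγ.le]
      ring
  · have hs : √α ≠ 0 := (Real.sqrt_pos.2 hα).ne'
    have hs2 : √α ^ 2 = α := Real.sq_sqrt hα.le
    set s := √α
    -- complete the square
    have hβ : s * (β / (2 * s)) * 2 = β := by field_simp
    set r := β / (2 * s)
    have hδ : 0 ≤ γ - r ^ 2 := by
      have : 0 ≤ α * (γ - r ^ 2) := by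
        rw [← hs2]; rw [← hβ, ← hs2] at hdisc; nlinarith
      exact nonneg_of_mul_nonneg_right this hα
    rcases hδ.eq_or_lt with hδ | hδ
    · refine Or.inr ⟨0, 1, s, r, by simpa using hs,
        Or.inl (MvPolynomial.funext fun x => ?_)⟩
      rw [eval_linSubst]
      simp
      linear_combination -x 0 ^ 2 * hs2 - x 0 * x 1 * hβ - x 1 ^ 2 * hδ
    · refine Or.inr ⟨s, r, 0, √(γ - r ^ 2), ?_, Or.inr (MvPolynomial.funext fun x => ?_)⟩
      · simpa using ⟨hs, (Real.sqrt_pos.2 hδ).ne'⟩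
      rw [eval_linSubst]
      simp [mul_pow, Real.sq_sqrt hδ.le]
      linear_combination -x 0 ^ 2 * hs2 - x 0 * x 1 * hβ

/-- A nonnegative bivariate quartic without constant and linear terms is a sum of squares of
polynomials of degree at most two. -/
theorem mem_sumSq_quadratics {f₂ f₃ f₄ : MvPolynomial (Fin 2) ℝ} (h₂ : f₂.IsHomogeneous 2)
    (h₃ : f₃.IsHomogeneous 3) (h₄ : f₄.IsHomogeneous 4)
    (hpos : ∀ x, 0 ≤ eval x (f₂ + f₃ + f₄)) : f₂ + f₃ + f₄ ∈ sumSq quadratics := by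
  have hineq := eval_component_inequalities h₂ h₃ h₄ hpos
  rcases exists_eq_linSubst h₂ (fun x => (hineq x).1) with rfl | ⟨a, b, c, d, hdet, h⟩
  · obtain rfl : f₃ = 0 := eq_zero_of_eval_sq_le fun x => by simpa using (hineq x).2.2
    simpa using mem_sumSq_quadratics_of_isHomogeneous_four h₄ fun x => (hineq x).2.1
  · obtain ⟨a', b', c', d', hinv, hinv'⟩ := exists_linSubst_inverse hdet
    have hmap : ∀ g ∈ quadratics, linSubst a b c d g ∈ quadratics := by
      intro g hg
      rw [mem_restrictTotalDegree] at hg ⊢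
      refine totalDegree_aeval_le (fun i => ?_) hg
      fin_cases i
      · exact ((isHomogeneous_C_mul_X a 0).add (isHomogeneous_C_mul_X b 1)).totalDegree_le
      · exact ((isHomogeneous_C_mul_X c 0).add (isHomogeneous_C_mul_X d 1)).totalDegree_le
    have h₃' := linSubst_isHomogeneous a' b' c' d' h₃
    have h₄' := linSubst_isHomogeneous a' b' c' d' h₄
    have hpos' : ∀ x, 0 ≤ eval x (linSubst a' b' c' d' (f₂ + f₃ + f₄)) := fun x => by
      rw [eval_linSubst]; exact hpos _
    rw [← hinv (f₂ + f₃ + f₄)]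
    refine algHom_mem_sumSq _ hmap ?_
    rcases h with rfl | rfl <;> rw [map_add, map_add, hinv'] at hpos' ⊢
    · exact mem_sumSq_of_quadratic_part_eq_X_sq h₃' h₄' hpos'
    · exact mem_sumSq_of_quadratic_part_eq_X_sq_add_X_sq h₃' h₄' hpos'

/-! ### Pseudo-moments and the relaxation -/

/-- The Riesz functional `L_y` of a sequence of moments: the linear form `x^α ↦ y_α`. -/
noncomputable def rieszFunctional (y : (Fin 2 →₀ ℕ) → ℝ) : MvPolynomial (Fin 2) ℝ →ₗ[ℝ] ℝ :=
  (basisMonomials (Fin 2) ℝ).constr ℝ y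

lemma rieszFunctional_monomial (y : (Fin 2 →₀ ℕ) → ℝ) (α : Fin 2 →₀ ℕ) (c : ℝ) :
    rieszFunctional y (monomial α c) = c * y α := by
  have h : monomial α c = c • basisMonomials (Fin 2) ℝ α := by
    simp [smul_monomial]
  rw [h, map_smul, rieszFunctional, Module.Basis.constr_basis, smul_eq_mul]

lemma rieszFunctional_eq_sum (y : (Fin 2 →₀ ℕ) → ℝ) (f : MvPolynomial (Fin 2) ℝ) :
    rieszFunctional y f = ∑ γ ∈ f.support, f.coeff γ * y γ := by
  conv_lhs => rw [f.as_sum, map_sum]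
  simp_rw [rieszFunctional_monomial]

/-- The moment matrix is the Gram matrix of `(f, g) ↦ L_y(f g)` in the monomial basis. -/
lemma rieszFunctional_sq_nonneg {y : (Fin 2 →₀ ℕ) → ℝ} (hy : (momentMatrix 2 y).PosSemidef)
    {g : MvPolynomial (Fin 2) ℝ} (hg : g ∈ quadratics) : 0 ≤ rieszFunctional y (g ^ 2) := by
  have : Finite (BivariateExponent 2) := Finsupp.finite_of_degree_le 2
  have := Fintype.ofFinite (BivariateExponent 2)
  have hsum : g = ∑ α : BivariateExponent 2, monomial α.1 (g.coeff α.1) := by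
    ext β
    rw [coeff_sum]
    simp_rw [coeff_monomial]
    by_cases hβ : β.degree ≤ 2
    · rw [Finset.sum_eq_single ⟨β, hβ⟩]
      · simp
      · intro α _ hα
        rw [if_neg fun h => hα (Subtype.ext h)]
      · simp
    · rw [Finset.sum_eq_zero]
      · by_contra h
        exact hβ ((le_totalDegree (mem_support_iff.2 h)).trans
          ((mem_restrictTotalDegree _ _ _).1 hg))
      · intro α _
        rw [if_neg]
        rintro rfl
        exact hβ α.2
  have := (Matrix.posSemidef_iff_dotProduct_mulVec.1 hy).2 (fun α => g.coeff α.1)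
  rw [hsum, sq, Finset.sum_mul_sum, map_sum]
  simp_rw [map_sum, monomial_mul, rieszFunctional_monomial]
  simp only [dotProduct, Matrix.mulVec, momentMatrix, Matrix.of_apply, Finset.mul_sum,
    Pi.star_apply, star_trivial] at this
  refine this.trans_eq (Finset.sum_congr rfl fun α _ => Finset.sum_congr rfl fun β _ => by ring)

lemma planeCurve_subset_lasserreRelaxation (p : MvPolynomial (Fin 2) ℝ) :
    planeCurve p ⊆ lasserreRelaxation 2 p := by
  intro x hx
  have : Finite (BivariateExponent 2) := Finsupp.finite_of_degree_le 2
  have := Fintype.ofFinite (BivariateExponent 2)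
  have hadd (α β : Fin 2 →₀ ℕ) : eval x (monomial (α + β) 1) =
      eval x (monomial α 1) * eval x (monomial β 1) := by
    rw [← map_mul, monomial_mul, one_mul]
  refine ⟨fun γ => eval x (monomial γ 1), by simp, by simp [eval_monomial],
    by simp [eval_monomial], ?_, ?_⟩
  · convert Matrix.posSemidef_vecMulVec_self_star
      (fun α : BivariateExponent 2 => eval x (monomial α.1 1)) using 1
    ext α β
    simp only [momentMatrix, Matrix.of_apply, Matrix.vecMulVec_apply, star_trivial]
    exact hadd _ _
  · ext α β
    have hα : α.1 = 0 := (Finsupp.degree_eq_zero_iff _).1 (Nat.le_zero.1 α.2)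
    have hβ : β.1 = 0 := (Finsupp.degree_eq_zero_iff _).1 (Nat.le_zero.1 β.2)
    rw [planeCurve, Set.mem_ofPred_eq] at hx
    rw [Matrix.zero_apply, ← hx]
    simp [localisingMatrix, hα, hβ, eval_eq]

lemma convex_lasserreRelaxation (p : MvPolynomial (Fin 2) ℝ) :
    Convex ℝ (lasserreRelaxation 2 p) := by
  rintro x ⟨y, h0, h1, h2, hM, hl⟩ x' ⟨y', h0', h1', h2', hM', hl'⟩ a b ha hb hab
  refine ⟨a • y + b • y', by simp [h0, h0', hab], by simp [h1, h1'], by simp [h2, h2'], ?_, ?_⟩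
  · exact (hM.smul ha).add (hM'.smul hb)
  · have : localisingMatrix (2 - 2) p (a • y + b • y') =
        a • localisingMatrix (2 - 2) p y + b • localisingMatrix (2 - 2) p y' := by
      ext α β
      simp only [localisingMatrix, Matrix.of_apply, Matrix.add_apply, Matrix.smul_apply,
        Pi.add_apply, Pi.smul_apply, smul_eq_mul, mul_add, Finset.sum_add_distrib, Finset.mul_sum]
      congr 1 <;> exact Finset.sum_congr rfl fun γ _ => by ring
    rw [this, hl, hl', smul_zero, smul_zero, add_zero]

/-! ### Concave quartics -/

/-- The translation `X i ↦ X i + z i`. -/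
noncomputable def translation (z : Fin 2 → ℝ) :
    MvPolynomial (Fin 2) ℝ →ₐ[ℝ] MvPolynomial (Fin 2) ℝ :=
  aeval fun i => X i + C (z i)

lemma eval_translation (z x : Fin 2 → ℝ) (f : MvPolynomial (Fin 2) ℝ) :
    eval x (translation z f) = eval (x + z) f := by
  rw [eval_comp_algHom]
  congr 2
  ext i; simp [translation]

lemma translation_neg_translation (z : Fin 2 → ℝ) (f : MvPolynomial (Fin 2) ℝ) :
    translation (-z) (translation z f) = f :=
  MvPolynomial.funext fun x => by rw [eval_translation, eval_translation, neg_add_cancel_right]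

lemma totalDegree_translation_le (z : Fin 2 → ℝ) {n : ℕ} {f : MvPolynomial (Fin 2) ℝ}
    (hf : f.totalDegree ≤ n) : (translation z f).totalDegree ≤ n := by
  refine totalDegree_aeval_le (fun i => (totalDegree_add _ _).trans ?_) hf
  simp

lemma totalDegree_translation (z : Fin 2 → ℝ) (f : MvPolynomial (Fin 2) ℝ) :
    (translation z f).totalDegree = f.totalDegree := by
  refine le_antisymm (totalDegree_translation_le z le_rfl) ?_
  conv_lhs => rw [← translation_neg_translation z f]
  exact totalDegree_translation_le _ le_rfl

lemma eq_sum_of_totalDegree_eq_four {f : MvPolynomial (Fin 2) ℝ} (hf : f.totalDegree = 4) :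
    f = homogeneousComponent 0 f + homogeneousComponent 1 f + (homogeneousComponent 2 f +
      homogeneousComponent 3 f + homogeneousComponent 4 f) := by
  have := sum_homogeneousComponent f
  rw [hf] at this
  conv_lhs => rw [← this]
  simp only [Finset.sum_range_succ, Finset.sum_range_zero]
  ring

/-- The restriction of a quartic to the line through the origin in direction `v`. -/
lemma eval_smul_of_totalDegree_eq_four {f : MvPolynomial (Fin 2) ℝ} (hf : f.totalDegree = 4)
    (t : ℝ) (v : Fin 2 → ℝ) :
    eval (t • v) f = eval v (homogeneousComponent 0 f) + t * eval v (homogeneousComponent 1 f) +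
      t ^ 2 * eval v (homogeneousComponent 2 f) + t ^ 3 * eval v (homogeneousComponent 3 f) +
      t ^ 4 * eval v (homogeneousComponent 4 f) := by
  conv_lhs => rw [eq_sum_of_totalDegree_eq_four hf]
  simp only [map_add,
    eval_smul_of_isHomogeneous (homogeneousComponent_isHomogeneous _ _) t v]
  ring

/-- A concave quartic lies below its first-order Taylor polynomial at the origin. -/
lemma eval_neg_higher_components_nonneg {f : MvPolynomial (Fin 2) ℝ} (hf : f.totalDegree = 4)
    (hconc : ConcaveOn ℝ Set.univ (fun x => eval x f)) (x : Fin 2 → ℝ) :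
    0 ≤ eval x (-homogeneousComponent 2 f + -homogeneousComponent 3 f +
      -homogeneousComponent 4 f) := by
  have h := nonneg_of_forall_pos (φ := fun t => t * eval x (homogeneousComponent 2 f) +
    t ^ 2 * eval x (homogeneousComponent 3 f) + t ^ 3 * eval x (homogeneousComponent 4 f) -
    (eval x (homogeneousComponent 2 f) + eval x (homogeneousComponent 3 f) +
      eval x (homogeneousComponent 4 f)))
    (by fun_prop) (fun t ht ht1 => by
      have h1 := hconc.2 (Set.mem_univ 0) (Set.mem_univ x) (sub_nonneg.2 ht1.le) ht.le
        (sub_add_cancel 1 t)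
      have e0 := eval_smul_of_totalDegree_eq_four hf 0 x
      have e1 := eval_smul_of_totalDegree_eq_four hf 1 x
      have et := eval_smul_of_totalDegree_eq_four hf t x
      simp only [smul_zero, zero_add, smul_eq_mul, zero_smul, one_smul] at h1 e0 e1
      rw [e0, e1, et] at h1
      refine nonneg_of_mul_nonneg_right (a := t) ?_ ht
      linarith)
  simp only [map_add, map_neg]
  linarith [h]

lemma concaveOn_translation {p : MvPolynomial (Fin 2) ℝ}
    (hconc : ConcaveOn ℝ Set.univ (fun x : Fin 2 → ℝ => eval x p)) (z : Fin 2 → ℝ) :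
    ConcaveOn ℝ Set.univ (fun x : Fin 2 → ℝ => eval x (translation z p)) := by
  simp_rw [eval_translation]
  simpa [Function.comp_def] using hconc.translate_left z

/-- Jensen's inequality for pseudo-moments: if `ℓ` is the first-order Taylor polynomial of `p` at the
mean `z` of a feasible `y`, then `ℓ - p` is a sum of squares and `p(z) = L_y(ℓ) ≥ L_y(p) = 0`. -/
lemma eval_nonneg_of_mem_lasserreRelaxation {p : MvPolynomial (Fin 2) ℝ} (hdeg : p.totalDegree = 4)
    (hconc : ConcaveOn ℝ Set.univ (fun x : Fin 2 → ℝ => eval x p)) {z : Fin 2 → ℝ}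
    (hz : z ∈ lasserreRelaxation 2 p) : 0 ≤ eval z p := by
  obtain ⟨y, h0, h1, h2, hM, hl⟩ := hz
  set q := translation z p with hq
  have hqdeg : q.totalDegree = 4 := (totalDegree_translation z p).trans hdeg
  have hqconc := concaveOn_translation hconc z
  have hLp : rieszFunctional y p = 0 := by
    have := congrFun (congrFun hl ⟨0, by simp⟩) ⟨0, by simp⟩
    simpa [localisingMatrix, rieszFunctional_eq_sum] using this
  -- the gap between `q` and its first-order Taylor polynomial
  have hsos := mem_sumSq_quadratics (homogeneousComponent_isHomogeneous 2 q).neg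
    (homogeneousComponent_isHomogeneous 3 q).neg (homogeneousComponent_isHomogeneous 4 q).neg
    (eval_neg_higher_components_nonneg hqdeg hqconc)
  have hL := map_mem_of_mem_sumSq (S := AddSubmonoid.nonneg ℝ)
    (rieszFunctional y : MvPolynomial (Fin 2) ℝ →+ ℝ)
    (fun g hg => rieszFunctional_sq_nonneg hM hg)
    (algHom_mem_sumSq (translation (-z)) (fun g hg => (mem_restrictTotalDegree _ _ _).2
      (totalDegree_translation_le _ ((mem_restrictTotalDegree _ _ _).1 hg))) hsos)
  have hsum : translation (-z) q = p := translation_neg_translation z p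
  obtain ⟨α, g, hg, h₁⟩ := exists_eq_C_mul_X_pow_add (homogeneousComponent_isHomogeneous 1 q)
  obtain ⟨β, rfl⟩ := exists_eq_C_of_isHomogeneous_zero hg
  have hX : ∀ i, rieszFunctional y (X i) = y (Finsupp.single i 1) := fun i => by
    simp [X, rieszFunctional_monomial]
  have hC : ∀ c, rieszFunctional y (C c) = c := fun c => by
    simp [← monomial_zero', rieszFunctional_monomial, h0]
  -- the linear part is centred at the mean `z` of the pseudo-moments
  have hlin : rieszFunctional y (translation (-z) (homogeneousComponent 1 q)) = 0 := by
    have : translation (-z) (homogeneousComponent 1 q) =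
        α • X 0 + β • X 1 + C (α * -z 0 + β * -z 1) := by
      rw [h₁]
      simp [translation, smul_eq_C_mul]
      ring
    rw [this]
    simp only [map_add, map_smul, hX, hC, h1, h2, smul_eq_mul]
    ring
  have hconst : rieszFunctional y (translation (-z) (homogeneousComponent 0 q)) = eval z p := by
    have hz : eval z p = eval 0 q := by rw [hq, eval_translation, zero_add]
    rw [hz, homogeneousComponent_zero]
    simp [translation, algebraMap_eq, hC, constantCoeff_eq]
  rw [eq_sum_of_totalDegree_eq_four hqdeg] at hsum
  rw [← hsum, map_add, map_add, map_add, map_add, hlin, hconst] at hLp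
  have hL' : 0 ≤ rieszFunctional y (translation (-z) (-homogeneousComponent 2 q +
    -homogeneousComponent 3 q + -homogeneousComponent 4 q)) := hL
  rw [← neg_add, ← neg_add, map_neg, map_neg] at hL'
  linarith

lemma exists_nonneg_quartic_eq_zero {c₀ c₁ c₂ c₃ c₄ : ℝ} (h₀ : 0 ≤ c₀) (h₄ : c₄ < 0) :
    ∃ t : ℝ, 0 ≤ t ∧ c₀ + t * c₁ + t ^ 2 * c₂ + t ^ 3 * c₃ + t ^ 4 * c₄ = 0 := by
  set S := |c₀| + |c₁| + |c₂| + |c₃| with hS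
  -- at `T ≥ 1` the lower terms are at most `S T³`, while `T⁴ c₄ = T³ (c₄ - S)`
  set T := 1 + S / -c₄ with hT
  have hT1 : 1 ≤ T := by
    have : 0 ≤ S / -c₄ := div_nonneg (by positivity) (by linarith)
    linarith
  have hTc : T * c₄ = c₄ - S := by
    rw [hT, div_neg, add_mul, neg_mul, div_mul_cancel₀ _ h₄.ne]; ring
  have hneg : c₀ + T * c₁ + T ^ 2 * c₂ + T ^ 3 * c₃ + T ^ 4 * c₄ ≤ 0 := by
    have h (k : ℕ) (hk : k ≤ 3) (c : ℝ) : T ^ k * c ≤ T ^ 3 * |c| :=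
      (mul_le_mul_of_nonneg_left (le_abs_self c) (by positivity)).trans
        (mul_le_mul_of_nonneg_right (pow_le_pow_right₀ hT1 hk) (abs_nonneg c))
    have e : T ^ 4 * c₄ = T ^ 3 * (c₄ - S) := by rw [← hTc]; ring
    have e₀ := h 0 (by norm_num) c₀
    have e₁ := h 1 (by norm_num) c₁
    have e₂ := h 2 (by norm_num) c₂
    have e₃ := h 3 (by norm_num) c₃
    have : T ^ 3 * c₄ ≤ 0 := mul_nonpos_of_nonneg_of_nonpos (by positivity) h₄.le
    rw [e, hS]
    linarith
  obtain ⟨t, ht, h⟩ := intermediate_value_Icc' (f := fun t : ℝ => c₀ + t * c₁ + t ^ 2 * c₂ +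
    t ^ 3 * c₃ + t ^ 4 * c₄) (zero_le_one.trans hT1) (by fun_prop) ⟨hneg, by simpa using h₀⟩
  exact ⟨t, ht.1, h⟩

lemma exists_smul_add_mem_planeCurve {p : MvPolynomial (Fin 2) ℝ} (hdeg : p.totalDegree = 4)
    {z v : Fin 2 → ℝ} (hz : 0 ≤ eval z p)
    (hv : eval v (homogeneousComponent 4 (translation z p)) < 0) :
    ∃ t : ℝ, 0 ≤ t ∧ t • v + z ∈ planeCurve p := by
  have hqdeg := (totalDegree_translation z p).trans hdeg
  have h0 : 0 ≤ eval v (homogeneousComponent 0 (translation z p)) := by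
    have := eval_smul_of_totalDegree_eq_four hqdeg 0 v
    rw [eval_translation] at this
    simp only [zero_smul, zero_add] at this
    linarith
  obtain ⟨t, ht, h⟩ := exists_nonneg_quartic_eq_zero h0 hv
    (c₁ := eval v (homogeneousComponent 1 (translation z p)))
    (c₂ := eval v (homogeneousComponent 2 (translation z p)))
    (c₃ := eval v (homogeneousComponent 3 (translation z p)))
  refine ⟨t, ht, ?_⟩
  rw [planeCurve, Set.mem_ofPred_eq, ← eval_translation, eval_smul_of_totalDegree_eq_four hqdeg, h]

/-- On a line along which the quartic part does not vanish, a concave quartic tends to `-∞` at both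
ends, so each point where it is nonnegative lies between two of its zeros. -/
lemma mem_convexHull_planeCurve {p : MvPolynomial (Fin 2) ℝ} (hdeg : p.totalDegree = 4)
    (hconc : ConcaveOn ℝ Set.univ (fun x : Fin 2 → ℝ => eval x p)) {z : Fin 2 → ℝ}
    (hz : 0 ≤ eval z p) : z ∈ convexHull ℝ (planeCurve p) := by
  set q := translation z p
  have hqdeg : q.totalDegree = 4 := (totalDegree_translation z p).trans hdeg
  have h4 : homogeneousComponent 4 q ≠ 0 := fun h4 => by
    have hle : (homogeneousComponent 0 q + homogeneousComponent 1 q + (homogeneousComponent 2 q +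
        homogeneousComponent 3 q + homogeneousComponent 4 q)).totalDegree ≤ 3 := by
      have hi (i : ℕ) (hi : i ≤ 3) : homogeneousComponent i q ∈ restrictTotalDegree (Fin 2) ℝ 3 :=
        (mem_restrictTotalDegree _ _ _).2
          ((homogeneousComponent_isHomogeneous i q).totalDegree_le.trans hi)
      rw [h4, add_zero, ← mem_restrictTotalDegree]
      exact add_mem (add_mem (hi 0 (by norm_num)) (hi 1 (by norm_num)))
        (add_mem (hi 2 (by norm_num)) (hi 3 le_rfl))
    rw [← eq_sum_of_totalDegree_eq_four hqdeg, hqdeg] at hle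
    norm_num at hle
  obtain ⟨v, hv⟩ : ∃ v, eval v (homogeneousComponent 4 q) ≠ 0 := by
    by_contra! h
    exact h4 (MvPolynomial.funext fun x => by simpa using h x)
  have hv' : eval v (homogeneousComponent 4 q) < 0 := by
    have := (eval_component_inequalities (homogeneousComponent_isHomogeneous 2 q).neg
      (homogeneousComponent_isHomogeneous 3 q).neg (homogeneousComponent_isHomogeneous 4 q).neg
      (eval_neg_higher_components_nonneg hqdeg (concaveOn_translation hconc z)) v).2.1
    rw [map_neg] at this
    exact lt_of_le_of_ne (by linarith) hv
  have hv'' : eval ((-1 : ℝ) • v) (homogeneousComponent 4 q) < 0 := by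
    rw [eval_smul_of_isHomogeneous (homogeneousComponent_isHomogeneous 4 q)]
    linarith
  obtain ⟨t, ht, hzt⟩ := exists_smul_add_mem_planeCurve hdeg hz hv'
  obtain ⟨s, hs, hzs⟩ := exists_smul_add_mem_planeCurve hdeg hz hv''
  rcases (add_nonneg hs ht).eq_or_lt with h | h
  · obtain rfl : t = 0 := by linarith
    rw [zero_smul, zero_add] at hzt
    exact subset_convexHull _ _ hzt
  · have hconv := (convex_convexHull ℝ (planeCurve p)) (subset_convexHull ℝ _ hzt)
      (subset_convexHull ℝ _ hzs) (div_nonneg hs h.le) (div_nonneg ht h.le) (by field_simp)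
    convert hconv using 1
    ext i
    simp
    field_simp
    ring

theorem lemma5 (p : MvPolynomial (Fin 2) ℝ) (hdeg : p.totalDegree = 4)
    (hconc : ConcaveOn ℝ Set.univ (fun x : Fin 2 → ℝ => MvPolynomial.eval x p)) :
    convexHull ℝ (planeCurve p) = lasserreRelaxation 2 p :=
  Set.Subset.antisymm
    (convexHull_min (planeCurve_subset_lasserreRelaxation p) (convex_lasserreRelaxation p))
    fun _ hz => mem_convexHull_planeCurve hdeg hconc
      (eval_nonneg_of_mem_lasserreRelaxation hdeg hconc hz)
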